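/- **Setting.** Transactions are executed by the Ethereum Virtual Machine (Cancun rules; the hash function, the precompiled contracts and the gas schedule may be arbitrary functions). A *location* of the state is the nonce, the balance, the code, or the existence of an account (an account exists if it has a non-zero nonce, a non-zero balance or non-empty code), or a storage cell $(a,k)$ of an account $a$. For a transaction $T$ executed in a state $\sigma$ (and in some block environment), $\mathrm{Rset}(T)$ is the set of locations read during the execution, including those read by calls that fail, and $\mathrm{Wset}(T)$ is the set of locations written and not rolled back; the fee credited to the block proposer is not counted. **Analyzer.** The input consists of a sequence $T_1,\dots,T_n$ of transactions in a preset order, a snapshot listing known accounts with their code (empty for externally owned accounts), and a decompiler, which assigns to every bytecode a three-address code $c_{TAC}$ with a call graph and with an entry point for each public function (named by a four-byte signature). Let $exitOpcodes=\{CALL,SELFDESTRUCT,CREATE,CREATE2\}$ and $staticExitOpcodes=\{STATICCALL,BALANCE\}$. In preprocessing a public function of a contract is labeled $transfer$, $transferFrom$ or $approve$ if it has the signature of that ERC-20 function; otherwise $exitsContract$ if $c_{TAC}$ has a path from it to an opcode in $exitOpcodes$; otherwise $staticExitsContract$ if it has a path to an opcode in $staticExitOpcodes$; otherwise $insideContract$.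 A transaction whose destination is a contract of the snapshot and whose calldata names one of its public functions gets the label of that function; one whose destination is an externally owned account of the snapshot is a simple payment; every other transaction (contract creation, unknown destination, no such function) is labeled $exitsContract$. For an ERC-20 transaction let $acc(T)$ be the set of accounts whose tokens or allowances it is about: $T.origin$ and the recipient ($transfer$), $T.origin$, the token owner and the recipient ($transferFrom$), $T.origin$ and the spender ($approve$). For $T$ placed before $T'$, the analyzer declares that $T'$ does not read from $T$ if neither is labeled $exitsContract$, $T'$ is not labeled $staticExitsContract$, and either $\{T.origin,T.dest\}\cap\{T'.origin,T'.dest\}=\emptyset$, or $T,T'$ are both ERC-20 transactions with $T.dest=T'.dest$ and $acc(T)\cap acc(T')=\emptyset$. The independence set $\mathcal T$ output for $T_j$ consists of the $T_i$, $i\neq j$, such that the later of $T_i,T_j$ is declared not to read from the earlier. A state is *compatible* with the snapshot if every account of the snapshot exists in it and has the code recorded there. **Assumptions.** 1. (Decompiler correctness.) For every contract $c$ of the snapshot, every public function $f$ of it with signature $s$ and every opcode $O$: if there is no path from $f$ to $O$ in $c_{TAC}$, then no transaction calling $c$ with signature $s$ in a compatible state reaches $O$ in the code run for $c$ (its own code,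 or code run through $DELEGATECALL$ or $CALLCODE$). 2. (ERC-20 contracts are well formed.) Let $U$ be the union of the sets $acc(T_i)$ over the ERC-20 transactions $T_i$ of the sequence. Every contract $d$ has an assignment of storage cells of $d$ to balances $balance(a)$ and allowances $allowance(a,b)$, injective on those with $a,b\in U$, such that every ERC-20 transaction $T$ to $d$ with $acc(T)\subseteq U$, executed in a compatible state, writes only the nonce and the balance of $T.origin$ and the cells of the data that $T$ is about, and reads only code and existence of accounts, nonces and balances of $T.origin$ and $d$, the cells of the data that $T$ is about, and cells of $d$ that hold no balance or allowance of accounts in $U$. Here a $transfer$ is about the balances of $T.origin$ and the recipient, a $transferFrom$ about the balances of owner and recipient and the allowance of the owner for $T.origin$, and an $approve$ about the allowance of $T.origin$ for the spender. **Theorem.** Under these assumptions, let $\mathcal T$ be the independence set that the analyzer outputs for $T_j$. Then for every $T\in\mathcal T$ that precedes $T_j$ in the preset order, $$\mathrm{Rset}(T_j)\cap \mathrm{Wset}(T)=\emptyset ,$$ whatever compatible states (and block environments) $T$ and $T_j$ are executed in; so there is no read-from conflict. -/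

import Mathlib

/-! ### The Ethereum Virtual Machine (Cancun rules), instrumented with read and write sets -/

namespace EVM

abbrev Word := BitVec 256
abbrev Address := BitVec 160
abbrev Byte := BitVec 8
abbrev Bytecode := List Byte
abbrev Selector := BitVec 32

/-- Big-endian value of a byte string. -/
def bytesToNat (bs : List Byte) : ℕ := bs.foldl (fun n b => 256 * n + b.toNat) 0

/-- The 32 bytes of a word, most significant byte first. -/
def wordBytes (w : Word) : List Byte :=
  (List.range 32).map fun i => (w >>> (8 * (31 - i))).setWidth 8

def addrBytes (a : Address) : List Byte :=
  (List.range 20).map fun i => (a >>> (8 * (19 - i))).setWidth 8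

/-- `len` bytes of `bs` from position `off` on, padded with zeros. -/
def slice (bs : List Byte) (off len : ℕ) : List Byte :=
  (List.range len).map fun i => bs.getD (off + i) 0

def Word.toAddr (w : Word) : Address := w.setWidth 160
def addrWord (a : Address) : Word := a.setWidth 256
def boolWord (b : Bool) : Word := if b then 1 else 0

/-! #### Instructions -/

inductive BinOp
  | add | mul | sub | div | sdiv | mod | smod | exp | signextend
  | lt | gt | slt | sgt | eq | and | or | xor | byte | shl | shr | sar
  deriving DecidableEq

inductive UnOp
  | iszero | not
  deriving DecidableEq

inductive TerOp
  | addmod | mulmod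
  deriving DecidableEq

/-- Instructions that push a value of the execution environment or of the machine state. -/
inductive EnvOp
  | address | origin | caller | callvalue | calldatasize | codesize | gasprice | returndatasize
  | coinbase | timestamp | number | prevrandao | gaslimit | chainid | basefee | blobbasefee
  | pc | msize | gas
  deriving DecidableEq

/-- The instruction set; `halt` is `STOP`. -/
inductive Op
  | halt | bin (b : BinOp) | un (u : UnOp) | ter (t : TerOp) | env (e : EnvOp)
  | keccak256 | calldataload | calldatacopy | codecopy | returndatacopy | blockhash | blobhash
  | pop | mload | mstore | mstore8 | mcopy | jump | jumpi | jumpdest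
  | push (n : ℕ) | dup (n : ℕ) | swap (n : ℕ)
  | balance | selfbalance | extcodesize | extcodecopy | extcodehash
  | sload | sstore | tload | tstore | log (n : ℕ)
  | create | create2 | call | callcode | delegatecall | staticcall
  | ret | revert | invalid | selfdestruct
  deriving DecidableEq

def decode (b : Byte) : Op :=
  match b.toNat with
  | 0x00 => .halt
  | 0x01 => .bin .add | 0x02 => .bin .mul | 0x03 => .bin .sub | 0x04 => .bin .div
  | 0x05 => .bin .sdiv | 0x06 => .bin .mod | 0x07 => .bin .smod
  | 0x08 => .ter .addmod | 0x09 => .ter .mulmod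
  | 0x0a => .bin .exp | 0x0b => .bin .signextend
  | 0x10 => .bin .lt | 0x11 => .bin .gt | 0x12 => .bin .slt | 0x13 => .bin .sgt
  | 0x14 => .bin .eq | 0x15 => .un .iszero | 0x16 => .bin .and | 0x17 => .bin .or
  | 0x18 => .bin .xor | 0x19 => .un .not | 0x1a => .bin .byte
  | 0x1b => .bin .shl | 0x1c => .bin .shr | 0x1d => .bin .sar
  | 0x20 => .keccak256
  | 0x30 => .env .address | 0x31 => .balance | 0x32 => .env .origin | 0x33 => .env .caller
  | 0x34 => .env .callvalue | 0x35 => .calldataload | 0x36 => .env .calldatasize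
  | 0x37 => .calldatacopy | 0x38 => .env .codesize | 0x39 => .codecopy
  | 0x3a => .env .gasprice | 0x3b => .extcodesize | 0x3c => .extcodecopy
  | 0x3d => .env .returndatasize | 0x3e => .returndatacopy | 0x3f => .extcodehash
  | 0x40 => .blockhash | 0x41 => .env .coinbase | 0x42 => .env .timestamp
  | 0x43 => .env .number | 0x44 => .env .prevrandao | 0x45 => .env .gaslimit
  | 0x46 => .env .chainid | 0x47 => .selfbalance | 0x48 => .env .basefee
  | 0x49 => .blobhash | 0x4a => .env .blobbasefee
  | 0x50 => .pop | 0x51 => .mload | 0x52 => .mstore | 0x53 => .mstore8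
  | 0x54 => .sload | 0x55 => .sstore | 0x56 => .jump | 0x57 => .jumpi
  | 0x58 => .env .pc | 0x59 => .env .msize | 0x5a => .env .gas | 0x5b => .jumpdest
  | 0x5c => .tload | 0x5d => .tstore | 0x5e => .mcopy
  | 0xf0 => .create | 0xf1 => .call | 0xf2 => .callcode | 0xf3 => .ret
  | 0xf4 => .delegatecall | 0xf5 => .create2 | 0xfa => .staticcall
  | 0xfd => .revert | 0xff => .selfdestruct
  | n =>
    if 0x5f ≤ n ∧ n ≤ 0x7f then .push (n - 0x5f)
    else if 0x80 ≤ n ∧ n ≤ 0x8f then .dup (n - 0x7f)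
    else if 0x90 ≤ n ∧ n ≤ 0x9f then .swap (n - 0x8f)
    else if 0xa0 ≤ n ∧ n ≤ 0xa4 then .log (n - 0xa0)
    else .invalid

def BinOp.eval (b : BinOp) (x y : Word) : Word :=
  match b with
  | .add => x + y
  | .mul => x * y
  | .sub => x - y
  | .div => if y = 0 then 0 else x / y
  | .sdiv => if y = 0 then 0 else x.sdiv y
  | .mod => if y = 0 then 0 else x % y
  | .smod => if y = 0 then 0 else x.srem y
  | .exp => x ^ y.toNat
  | .signextend =>
    if x.toNat < 31 then (y.setWidth (8 * (x.toNat + 1))).signExtend 256 else y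
  | .lt => boolWord (x.ult y)
  | .gt => boolWord (y.ult x)
  | .slt => boolWord (x.slt y)
  | .sgt => boolWord (y.slt x)
  | .eq => boolWord (x == y)
  | .and => x &&& y
  | .or => x ||| y
  | .xor => x ^^^ y
  | .byte => if x.toNat < 32 then (y >>> (8 * (31 - x.toNat))) &&& 0xff else 0
  | .shl => if x.toNat < 256 then y <<< x.toNat else 0
  | .shr => if x.toNat < 256 then y >>> x.toNat else 0
  | .sar => y.sshiftRight (min x.toNat 255)

def UnOp.eval (u : UnOp) (x : Word) : Word :=
  match u with
  | .iszero => boolWord (x == 0)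
  | .not => ~~~x

def TerOp.eval (t : TerOp) (x y z : Word) : Word :=
  match t with
  | .addmod => if z = 0 then 0 else BitVec.ofNat 256 ((x.toNat + y.toNat) % z.toNat)
  | .mulmod => if z = 0 then 0 else BitVec.ofNat 256 ((x.toNat * y.toNat) % z.toNat)

/-- Is position `n` a `JUMPDEST` that is not inside the data of a `PUSH`? The scan is at `pos`. -/
def jumpScan (code : Bytecode) (n : ℕ) : ℕ → ℕ → Bool
  | 0, _ => false
  | fuel + 1, pos =>
    if pos < n then
      match decode (code.getD pos 0) with
      | .push k => jumpScan code n fuel (pos + 1 + k)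
      | _ => jumpScan code n fuel (pos + 1)
    else decide (pos = n ∧ n < code.length) && decide (decode (code.getD n 0) = .jumpdest)

def isJumpDest (code : Bytecode) (n : ℕ) : Bool := jumpScan code n (n + 1) 0

/-! #### World state, locations, transactions -/

structure Account where
  nonce : ℕ
  balance : ℕ
  code : Bytecode
  storage : Word → Word

/-- An account exists in the state exactly if it is not empty (no nonce, no balance, no code). -/
def Account.alive (x : Account) : Bool :=
  decide (x.nonce ≠ 0 ∨ x.balance ≠ 0 ∨ x.code ≠ [])

abbrev World := Address → Account

/-- The locations of the shared state. `existence a` is the presence of the account `a`. -/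
inductive Loc
  | nonce (a : Address)
  | balance (a : Address)
  | code (a : Address)
  | existence (a : Address)
  | storage (a : Address) (k : Word)
  deriving DecidableEq

/-- A transaction; `dest = none` is a contract creation. -/
structure Tx where
  origin : Address
  dest : Option Address
  value : ℕ
  data : List Byte
  nonce : ℕ
  gasLimit : ℕ
  maxFee : ℕ
  maxTip : ℕ
  accessList : List (Address × List Word)
  blobHashes : List Word
  maxBlobFee : ℕ

structure BlockEnv where
  coinbase : Address
  timestamp : Word
  number : Word
  prevrandao : Word
  gasLimit : Word
  chainId : Word
  baseFee : ℕ
  blobBaseFee : ℕ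
  blockHash : Word → Word

/-- What the price of an instruction may depend on. `warm`: the touched account or cell was touched
before in the transaction. `cur`, `orig`: present value, and value before the transaction, of the
cell that `SSTORE` writes. `targetAlive`: existence of the target of `CALL` / `SELFDESTRUCT`.
`endowment`: the balance that `SELFDESTRUCT` moves. -/
structure GasView where
  op : Op
  stack : List Word
  memWords : ℕ
  gas : ℕ
  warm : Bool
  cur : Word
  orig : Word
  targetAlive : Bool
  endowment : ℕ

/-- The parts of the protocol that play no role for state accesses: the hash function, the
precompiled contracts (output and gas used, `none` for failure), and the gas schedule. They are
arbitrary functions; nothing is assumed about them. -/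
structure Params where
  keccak : List Byte → Word
  precompile : Address → Option (List Byte → ℕ → Option (List Byte × ℕ))
  intrinsicGas : Tx → ℕ
  gasCost : GasView → ℕ
  gasRefund : GasView → ℤ
  depositCost : ℕ → ℕ

/-- The part of the machine state that is rolled back when a call fails. `writes` lists the
locations written so far and not rolled back. `transient` is the transaction-local storage. -/
structure Substate where
  world : World
  transient : Address → Word → Word
  writes : List Loc
  warmAddrs : List Address
  warmKeys : List (Address × Word)
  refund : ℤ
  created : List Address
  doomed : List Address
  events : List (Address × List Word × List Byte)

/-- Replace the account `a` by `x`, where `ls` are the fields of `a` that are written; the existence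
of `a` is written as well if it changes. -/
def Substate.put (s : Substate) (a : Address) (x : Account) (ls : List Loc) : Substate :=
  { s with
    world := Function.update s.world a x
    writes := ls ++ (if x.alive = (s.world a).alive then [] else [Loc.existence a]) ++ s.writes }

/-- Move `v` wei from `a` to `b`. -/
def Substate.transfer (s : Substate) (a b : Address) (v : ℕ) : Substate :=
  if v = 0 then s else
    let s1 := s.put a { s.world a with balance := (s.world a).balance - v } [Loc.balance a]
    s1.put b { s1.world b with balance := (s1.world b).balance + v } [Loc.balance b]

def transferReads (a b : Address) (v : ℕ) : List Loc :=
  if v = 0 then [] else [Loc.balance a, Loc.balance b]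

/-- A call frame. `target = some a` if the frame runs the init code of the new contract `a`.
`own` tells whether the frame runs for the account called by the transaction itself: it holds for
the outermost frame and is inherited through `DELEGATECALL` and `CALLCODE` only. `saved` is the
state to return to on failure. -/
structure Frame where
  self : Address
  caller : Address
  value : ℕ
  input : List Byte
  code : Bytecode
  isStatic : Bool
  own : Bool
  target : Option Address
  outOff : ℕ
  outSize : ℕ
  saved : Substate
  gas : ℕ
  pc : ℕ := 0
  stack : List Word := []
  mem : ℕ → Byte := fun _ => 0
  memWords : ℕ := 0
  retData : List Byte := []

/-- The instruction about to be executed. -/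
def Frame.op (f : Frame) : Op := decode (f.code.getD f.pc 0)

/-- `reads` lists all locations read so far, including those read by calls that failed. The head
of `frames` is the running frame. -/
structure Config where
  sub : Substate
  reads : List Loc
  frames : List Frame
  halted : Bool

structure Ctx where
  P : Params
  env : BlockEnv
  tx : Tx
  orig : World

def gasPrice (env : BlockEnv) (t : Tx) : ℕ := min t.maxFee (env.baseFee + t.maxTip)
def blobGas (t : Tx) : ℕ := 131072 * t.blobHashes.length

/-! #### Instructions that do not touch the shared state -/

def readMem (m : ℕ → Byte) (off len : ℕ) : List Byte := (List.range len).map fun i => m (off + i)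

def writeMem (m : ℕ → Byte) (off : ℕ) (bs : List Byte) : ℕ → Byte := fun n =>
  if off ≤ n ∧ n < off + bs.length then bs.getD (n - off) 0 else m n

def expand (w off len : ℕ) : ℕ := if len = 0 then w else max w ((off + len + 31) / 32)

/-- Go to the next instruction with the given stack. -/
def Frame.next (f : Frame) (s : List Word) : Frame := { f with stack := s, pc := f.pc + 1 }

def Frame.store (f : Frame) (off : ℕ) (bs : List Byte) : Frame :=
  { f with mem := writeMem f.mem off bs, memWords := expand f.memWords off bs.length }

def EnvOp.eval (e : EnvOp) (cx : Ctx) (f : Frame) : Word :=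
  match e with
  | .address => addrWord f.self
  | .origin => addrWord cx.tx.origin
  | .caller => addrWord f.caller
  | .callvalue => BitVec.ofNat 256 f.value
  | .calldatasize => BitVec.ofNat 256 f.input.length
  | .codesize => BitVec.ofNat 256 f.code.length
  | .gasprice => BitVec.ofNat 256 (gasPrice cx.env cx.tx)
  | .returndatasize => BitVec.ofNat 256 f.retData.length
  | .coinbase => addrWord cx.env.coinbase
  | .timestamp => cx.env.timestamp
  | .number => cx.env.number
  | .prevrandao => cx.env.prevrandao
  | .gaslimit => cx.env.gasLimit
  | .chainid => cx.env.chainId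
  | .basefee => BitVec.ofNat 256 cx.env.baseFee
  | .blobbasefee => BitVec.ofNat 256 cx.env.blobBaseFee
  | .pc => BitVec.ofNat 256 f.pc
  | .msize => BitVec.ofNat 256 (32 * f.memWords)
  | .gas => BitVec.ofNat 256 f.gas

/-- One step of an instruction that works on the frame alone; `none` is an exceptional halt. -/
def pureStep (cx : Ctx) (f : Frame) (op : Op) : Option Frame :=
  match op with
  | .bin b => match f.stack with
    | x :: y :: s => some (f.next (b.eval x y :: s))
    | _ => none
  | .un u => match f.stack with
    | x :: s => some (f.next (u.eval x :: s))
    | _ => none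
  | .ter t => match f.stack with
    | x :: y :: z :: s => some (f.next (t.eval x y z :: s))
    | _ => none
  | .env e => some (f.next (e.eval cx f :: f.stack))
  | .keccak256 => match f.stack with
    | off :: len :: s => some
        { f.next (cx.P.keccak (readMem f.mem off.toNat len.toNat) :: s) with
          memWords := expand f.memWords off.toNat len.toNat }
    | _ => none
  | .calldataload => match f.stack with
    | i :: s => some (f.next (BitVec.ofNat 256 (bytesToNat (slice f.input i.toNat 32)) :: s))
    | _ => none
  | .calldatacopy => match f.stack with
    | d :: o :: l :: s => some ((f.next s).store d.toNat (slice f.input o.toNat l.toNat))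
    | _ => none
  | .codecopy => match f.stack with
    | d :: o :: l :: s => some ((f.next s).store d.toNat (slice f.code o.toNat l.toNat))
    | _ => none
  | .returndatacopy => match f.stack with
    | d :: o :: l :: s =>
      if o.toNat + l.toNat ≤ f.retData.length then
        some ((f.next s).store d.toNat (slice f.retData o.toNat l.toNat))
      else none
    | _ => none
  | .blockhash => match f.stack with
    | x :: s => some (f.next (cx.env.blockHash x :: s))
    | _ => none
  | .blobhash => match f.stack with
    | x :: s => some (f.next (cx.tx.blobHashes.getD x.toNat 0 :: s))
    | _ => none
  | .pop => match f.stack with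
    | _ :: s => some (f.next s)
    | _ => none
  | .mload => match f.stack with
    | o :: s => some
        { f.next (BitVec.ofNat 256 (bytesToNat (readMem f.mem o.toNat 32)) :: s) with
          memWords := expand f.memWords o.toNat 32 }
    | _ => none
  | .mstore => match f.stack with
    | o :: x :: s => some ((f.next s).store o.toNat (wordBytes x))
    | _ => none
  | .mstore8 => match f.stack with
    | o :: x :: s => some ((f.next s).store o.toNat [x.setWidth 8])
    | _ => none
  | .mcopy => match f.stack with
    | d :: o :: l :: s =>
      let g := (f.next s).store d.toNat (readMem f.mem o.toNat l.toNat)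
      some { g with memWords := expand g.memWords o.toNat l.toNat }
    | _ => none
  | .jump => match f.stack with
    | d :: s => if isJumpDest f.code d.toNat then some { f with stack := s, pc := d.toNat } else none
    | _ => none
  | .jumpi => match f.stack with
    | d :: b :: s =>
      if b = 0 then some (f.next s)
      else if isJumpDest f.code d.toNat then some { f with stack := s, pc := d.toNat } else none
    | _ => none
  | .jumpdest => some (f.next f.stack)
  | .push n => some
      { f with
        stack := BitVec.ofNat 256 (bytesToNat (slice f.code (f.pc + 1) n)) :: f.stack
        pc := f.pc + 1 + n }
  | .dup n => match f.stack[n - 1]? with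
    | some x => some (f.next (x :: f.stack))
    | none => none
  | .swap n => match f.stack, f.stack[n]? with
    | x :: s, some y => some (f.next (y :: s.set (n - 1) x))
    | _, _ => none
  | _ => none

/-! #### Instructions that read or write state without entering another frame -/

/-- The new substate, the locations read, and the new frame; `none` is an exceptional halt. -/
def stateStep (cx : Ctx) (st : Substate) (f : Frame) (op : Op) :
    Option (Substate × List Loc × Frame) :=
  match op with
  | .balance => match f.stack with
    | x :: s => some (st, [Loc.balance x.toAddr],
        f.next (BitVec.ofNat 256 (st.world x.toAddr).balance :: s))
    | _ => none
  | .selfbalance => some (st, [Loc.balance f.self],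
      f.next (BitVec.ofNat 256 (st.world f.self).balance :: f.stack))
  | .extcodesize => match f.stack with
    | x :: s => some (st, [Loc.code x.toAddr],
        f.next (BitVec.ofNat 256 (st.world x.toAddr).code.length :: s))
    | _ => none
  | .extcodecopy => match f.stack with
    | x :: d :: o :: l :: s => some (st, [Loc.code x.toAddr],
        (f.next s).store d.toNat (slice (st.world x.toAddr).code o.toNat l.toNat))
    | _ => none
  | .extcodehash => match f.stack with
    | x :: s => some (st, [Loc.existence x.toAddr, Loc.code x.toAddr],
        f.next ((if (st.world x.toAddr).alive then cx.P.keccak (st.world x.toAddr).code else 0)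
          :: s))
    | _ => none
  | .sload => match f.stack with
    | k :: s => some (st, [Loc.storage f.self k], f.next ((st.world f.self).storage k :: s))
    | _ => none
  | .sstore => match f.stack with
    | k :: v :: s =>
      if f.isStatic then none else
        let x := st.world f.self
        some (st.put f.self { x with storage := Function.update x.storage k v }
          [Loc.storage f.self k], [], f.next s)
    | _ => none
  | .tload => match f.stack with
    | k :: s => some (st, [], f.next (st.transient f.self k :: s))
    | _ => none
  | .tstore => match f.stack with
    | k :: v :: s =>
      if f.isStatic then none else
        let m := Function.update (st.transient f.self) k v
        some ({ st with transient := Function.update st.transient f.self m }, [], f.next s)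
    | _ => none
  | .log n => match f.stack with
    | o :: l :: s =>
      if f.isStatic ∨ s.length < n then none else
        some ({ st with events := (f.self, s.take n, readMem f.mem o.toNat l.toNat) :: st.events },
          [], { f.next (s.drop n) with memWords := expand f.memWords o.toNat l.toNat })
    | _ => none
  | _ => none

/-! #### Leaving and entering frames -/

inductive Outcome
  | success (out : List Byte)
  | revert (out : List Byte)
  | exception

/-- End of the transaction: unused gas is paid back to the origin, and the contracts that were
created and destroyed in the transaction disappear (all their cells in use were written in it).
The fee credited to the block proposer is not an access of the transaction. -/
def finalize (cx : Ctx) (c : Config) (gasLeft : ℕ) : Config :=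
  let back := gasLeft + min c.sub.refund.toNat ((cx.tx.gasLimit - gasLeft) / 5)
  let x := c.sub.world cx.tx.origin
  let s := c.sub.put cx.tx.origin
    { x with balance := x.balance + back * gasPrice cx.env cx.tx } [Loc.balance cx.tx.origin]
  { sub := s.doomed.foldl (fun s a => s.put a ⟨0, 0, [], fun _ => 0⟩
      [Loc.nonce a, Loc.balance a, Loc.code a]) s
    reads := Loc.balance cx.tx.origin :: c.reads
    frames := []
    halted := true }

/-- Substate, gas, stack entry and return data that a frame hands back. -/
def settle (cx : Ctx) (s : Substate) (f : Frame) (r : Outcome) :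
    Substate × ℕ × Word × List Byte :=
  match r with
  | .exception => (f.saved, 0, 0, [])
  | .revert out => (f.saved, f.gas, 0, out)
  | .success out => match f.target with
    | none => (s, f.gas, 1, out)
    | some a =>
      if out.length ≤ 24576 ∧ out.head? ≠ some 0xEF ∧ cx.P.depositCost out.length ≤ f.gas then
        (s.put a { s.world a with code := out } [Loc.code a],
          f.gas - cx.P.depositCost out.length, addrWord a, [])
      else (f.saved, 0, 0, [])

/-- The frame `f` ends with outcome `r`; `rest` are the frames below it. -/
def finish (cx : Ctx) (c : Config) (f : Frame) (rest : List Frame) (r : Outcome) : Config :=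
  let q := settle cx c.sub f r
  match rest with
  | [] => finalize cx { c with sub := q.1 } q.2.1
  | p :: ps =>
    { c with
      sub := q.1
      frames := { p with
        gas := p.gas + q.2.1
        stack := q.2.2.1 :: p.stack
        retData := q.2.2.2
        mem := writeMem p.mem f.outOff (q.2.2.2.take f.outSize) } :: ps }

/-- Start the frame `f`, whose code is that of the account `codeAddr`, on top of `ps`. -/
def enter (cx : Ctx) (c : Config) (f : Frame) (codeAddr : Address) (ps : List Frame) : Config :=
  match cx.P.precompile codeAddr with
  | some p => match p f.input f.gas with
    | some (out, used) =>
      if used ≤ f.gas then finish cx c { f with gas := f.gas - used } ps (.success out)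
      else finish cx c f ps .exception
    | none => finish cx c f ps .exception
  | none => { c with frames := f :: ps }

/-- The data of a message call. `moved`: ether transferred to the callee; `needed`: balance that the
caller must have. -/
structure CallReq where
  gasReq : ℕ
  codeAddr : Address
  self : Address
  caller : Address
  value : ℕ
  moved : ℕ
  needed : ℕ
  isStatic : Bool
  own : Bool
  inOff : ℕ
  inSize : ℕ
  outOff : ℕ
  outSize : ℕ
  rest : List Word

def callReq (f : Frame) (op : Op) : Option CallReq :=
  match op with
  | .call => match f.stack with
    | g :: a :: v :: io :: il :: oo :: ol :: s =>
      if f.isStatic ∧ v ≠ 0 then none else some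
        { gasReq := g.toNat, codeAddr := a.toAddr, self := a.toAddr, caller := f.self
          value := v.toNat, moved := v.toNat, needed := v.toNat
          isStatic := f.isStatic, own := false
          inOff := io.toNat, inSize := il.toNat, outOff := oo.toNat, outSize := ol.toNat
          rest := s }
    | _ => none
  | .callcode => match f.stack with
    | g :: a :: v :: io :: il :: oo :: ol :: s => some
        { gasReq := g.toNat, codeAddr := a.toAddr, self := f.self, caller := f.self
          value := v.toNat, moved := 0, needed := v.toNat
          isStatic := f.isStatic, own := f.own
          inOff := io.toNat, inSize := il.toNat, outOff := oo.toNat, outSize := ol.toNat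
          rest := s }
    | _ => none
  | .delegatecall => match f.stack with
    | g :: a :: io :: il :: oo :: ol :: s => some
        { gasReq := g.toNat, codeAddr := a.toAddr, self := f.self, caller := f.caller
          value := f.value, moved := 0, needed := 0
          isStatic := f.isStatic, own := f.own
          inOff := io.toNat, inSize := il.toNat, outOff := oo.toNat, outSize := ol.toNat
          rest := s }
    | _ => none
  | .staticcall => match f.stack with
    | g :: a :: io :: il :: oo :: ol :: s => some
        { gasReq := g.toNat, codeAddr := a.toAddr, self := a.toAddr, caller := f.self
          value := 0, moved := 0, needed := 0
          isStatic := true, own := false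
          inOff := io.toNat, inSize := il.toNat, outOff := oo.toNat, outSize := ol.toNat
          rest := s }
    | _ => none
  | _ => none

/-- A message call from `f`. -/
def doCall (cx : Ctx) (c : Config) (f : Frame) (rest : List Frame) (q : CallReq) : Config :=
  let g := min q.gasReq (f.gas - f.gas / 64)
  let stipend := if q.needed = 0 then 0 else 2300
  let f1 : Frame := { f.next q.rest with
    memWords := expand (expand f.memWords q.inOff q.inSize) q.outOff q.outSize }
  let c1 : Config := { c with
    reads := Loc.code q.codeAddr :: (if q.needed = 0 then [] else [Loc.balance f.self])
      ++ transferReads f.self q.self q.moved ++ c.reads }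
  if (c.sub.world f.self).balance < q.needed ∨ 1024 ≤ rest.length then
    { c1 with frames :=
        { f1 with stack := 0 :: f1.stack, retData := [], gas := f.gas + stipend } :: rest }
  else
    enter cx { c1 with sub := c.sub.transfer f.self q.self q.moved }
      { self := q.self, caller := q.caller, value := q.value
        input := readMem f.mem q.inOff q.inSize, code := (c.sub.world q.codeAddr).code
        isStatic := q.isStatic, own := q.own, target := none
        outOff := q.outOff, outSize := q.outSize, saved := c.sub, gas := g + stipend }
      q.codeAddr ({ f1 with gas := f.gas - g } :: rest)

/-- RLP encoding of the pair of an address and a nonce. -/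
def rlpAddrNonce (a : Address) (n : ℕ) : List Byte :=
  let ds : List Byte := ((Nat.digits 256 n).reverse).map (BitVec.ofNat 8)
  let nb : List Byte := if n = 0 then [0x80] else if n < 128 then ds
    else BitVec.ofNat 8 (0x80 + ds.length) :: ds
  let payload : List Byte := 0x94 :: addrBytes a ++ nb
  BitVec.ofNat 8 (0xc0 + payload.length) :: payload

def createAddr (P : Params) (a : Address) (n : ℕ) : Address := (P.keccak (rlpAddrNonce a n)).toAddr

def create2Addr (P : Params) (a : Address) (salt : Word) (code : Bytecode) : Address :=
  (P.keccak (0xff :: addrBytes a ++ wordBytes salt ++ wordBytes (P.keccak code))).toAddr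

/-- Run `initCode` for the new contract `a`, with endowment `v` from `creator`. -/
def openContract (c : Config) (creator a : Address) (v : ℕ) (initCode : Bytecode) (gas : ℕ)
    (ps : List Frame) (own : Bool) : Config :=
  let c1 : Config := { c with
    reads := Loc.nonce a :: Loc.code a :: transferReads creator a v ++ c.reads }
  let fr : Frame :=
    { self := a, caller := creator, value := v, input := [], code := initCode
      isStatic := false, own := own, target := some a, outOff := 0, outSize := 0
      saved := c.sub, gas := gas }
  if (c.sub.world a).nonce ≠ 0 ∨ (c.sub.world a).code ≠ [] then
    -- address collision: the frame fails at its first instruction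
    { c1 with frames := { fr with code := [0xfe] } :: ps }
  else
    let s1 := c.sub.put a { c.sub.world a with nonce := 1 } [Loc.nonce a]
    let s2 := s1.transfer creator a v
    { c1 with sub := { s2 with created := a :: s2.created }, frames := fr :: ps }

def doCreate (cx : Ctx) (c : Config) (f : Frame) (rest : List Frame)
    (v off len : ℕ) (salt : Option Word) (stack : List Word) : Config :=
  let f1 : Frame := { f.next stack with memWords := expand f.memWords off len, retData := [] }
  let x := c.sub.world f.self
  let c1 : Config := { c with reads := Loc.nonce f.self :: Loc.balance f.self :: c.reads }
  if f.isStatic ∨ 49152 < len then finish cx c f rest .exception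
  else if x.balance < v ∨ 1024 ≤ rest.length ∨ 2 ^ 64 - 1 ≤ x.nonce then
    { c1 with frames := { f1 with stack := 0 :: stack } :: rest }
  else
    let initCode := readMem f.mem off len
    let a := match salt with
      | none => createAddr cx.P f.self x.nonce
      | some w => create2Addr cx.P f.self w initCode
    let s1 := c.sub.put f.self { x with nonce := x.nonce + 1 } [Loc.nonce f.self]
    let g := f.gas - f.gas / 64
    openContract { c1 with sub := { s1 with warmAddrs := a :: s1.warmAddrs } } f.self a v
      initCode g ({ f1 with gas := f.gas - g } :: rest) false

def doSelfdestruct (cx : Ctx) (c : Config) (f : Frame) (rest : List Frame) (b : Address) :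
    Config :=
  let bal := (c.sub.world f.self).balance
  let s1 := c.sub.transfer f.self b bal
  let s2 := if f.self ∈ s1.created then { s1 with doomed := f.self :: s1.doomed } else s1
  let c1 : Config :=
    { c with sub := s2, reads := Loc.balance f.self :: transferReads f.self b bal ++ c.reads }
  finish cx c1 f rest (.success [])

/-! #### Gas, the step function, transactions -/

/-- The account that an instruction touches through its operand. -/
def touchedAddr (f : Frame) (op : Op) : Option Address :=
  match op with
  | .balance | .extcodesize | .extcodecopy | .extcodehash | .selfdestruct =>
    f.stack[0]?.map Word.toAddr
  | .call | .callcode | .delegatecall | .staticcall => f.stack[1]?.map Word.toAddr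
  | _ => none

/-- The storage key that an instruction touches. -/
def touchedKey (f : Frame) (op : Op) : Option Word :=
  match op with
  | .sload | .sstore => f.stack[0]?
  | _ => none

def isWarm (cx : Ctx) (s : Substate) (f : Frame) (op : Op) : Bool :=
  match touchedAddr f op, touchedKey f op with
  | some a, _ => decide (a ∈ s.warmAddrs) || (cx.P.precompile a).isSome
  | none, some k => decide ((f.self, k) ∈ s.warmKeys)
  | none, none => true

def gasView (cx : Ctx) (s : Substate) (f : Frame) (op : Op) : GasView :=
  { op := op, stack := f.stack, memWords := f.memWords, gas := f.gas
    warm := isWarm cx s f op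
    cur := match op, f.stack with
      | .sstore, k :: _ => (s.world f.self).storage k
      | _, _ => 0
    orig := match op, f.stack with
      | .sstore, k :: _ => (cx.orig f.self).storage k
      | _, _ => 0
    targetAlive := match op, touchedAddr f op with
      | .call, some a => (s.world a).alive
      | .selfdestruct, some a => (s.world a).alive
      | _, _ => true
    endowment := match op with
      | .selfdestruct => (s.world f.self).balance
      | _ => 0 }

/-- The locations that the price of an instruction depends on. -/
def gasReads (f : Frame) (op : Op) : List Loc :=
  match op with
  | .sstore => match f.stack with
    | k :: _ => [Loc.storage f.self k]
    | _ => []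
  | .call => (touchedAddr f op).toList.map Loc.existence
  | .selfdestruct => Loc.balance f.self :: (touchedAddr f op).toList.map Loc.existence
  | _ => []

def Substate.touch (s : Substate) (f : Frame) (op : Op) (r : ℤ) : Substate :=
  { s with
    warmAddrs := (touchedAddr f op).toList ++ s.warmAddrs
    warmKeys := (touchedKey f op).toList.map (fun k => (f.self, k)) ++ s.warmKeys
    refund := s.refund + r }

/-- Execute the instruction `op`, already paid for, in the frame `f`. -/
def exec (cx : Ctx) (c : Config) (f : Frame) (rest : List Frame) (op : Op) : Config :=
  match op with
  | .halt => finish cx c f rest (.success [])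
  | .invalid => finish cx c f rest .exception
  | .ret => match f.stack with
    | o :: l :: _ => finish cx c f rest (.success (readMem f.mem o.toNat l.toNat))
    | _ => finish cx c f rest .exception
  | .revert => match f.stack with
    | o :: l :: _ => finish cx c f rest (.revert (readMem f.mem o.toNat l.toNat))
    | _ => finish cx c f rest .exception
  | .selfdestruct => match f.stack with
    | b :: _ =>
      if f.isStatic then finish cx c f rest .exception else doSelfdestruct cx c f rest b.toAddr
    | _ => finish cx c f rest .exception
  | .create => match f.stack with
    | v :: o :: l :: s => doCreate cx c f rest v.toNat o.toNat l.toNat none s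
    | _ => finish cx c f rest .exception
  | .create2 => match f.stack with
    | v :: o :: l :: w :: s => doCreate cx c f rest v.toNat o.toNat l.toNat (some w) s
    | _ => finish cx c f rest .exception
  | .call | .callcode | .delegatecall | .staticcall => match callReq f op with
    | some q => doCall cx c f rest q
    | none => finish cx c f rest .exception
  | .balance | .selfbalance | .extcodesize | .extcodecopy | .extcodehash
  | .sload | .sstore | .tload | .tstore | .log _ => match stateStep cx c.sub f op with
    | some (s, rs, f1) =>
      if 1024 < f1.stack.length then finish cx c f rest .exception
      else { c with sub := s, reads := rs ++ c.reads, frames := f1 :: rest }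
    | none => finish cx c f rest .exception
  | _ => match pureStep cx f op with
    | some f1 =>
      if 1024 < f1.stack.length then finish cx c f rest .exception
      else { c with frames := f1 :: rest }
    | none => finish cx c f rest .exception

/-- One machine step; a configuration without frames is final. -/
def step (cx : Ctx) (c : Config) : Config :=
  match c.frames with
  | [] => c
  | f :: rest =>
    let v := gasView cx c.sub f f.op
    let c1 : Config := { c with reads := gasReads f f.op ++ c.reads }
    if f.gas < cx.P.gasCost v then finish cx c1 f rest .exception
    else exec cx { c1 with sub := c.sub.touch f f.op (cx.P.gasRefund v) }
      { f with gas := f.gas - cx.P.gasCost v } rest f.op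

/-- A transaction that is not valid has no effect. -/
def validTx (P : Params) (env : BlockEnv) (t : Tx) (σ : World) : Bool :=
  let x := σ t.origin
  x.alive && decide (x.code = [] ∧ x.nonce = t.nonce ∧ P.intrinsicGas t ≤ t.gasLimit
    ∧ env.baseFee ≤ t.maxFee
    ∧ (t.blobHashes = [] ∨ env.blobBaseFee ≤ t.maxBlobFee)
    ∧ t.gasLimit * t.maxFee + t.value + blobGas t * t.maxBlobFee ≤ x.balance)

/-- The configuration in which the transaction `t` starts in the state `σ`. -/
def start (P : Params) (env : BlockEnv) (t : Tx) (σ : World) : Config :=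
  let cx : Ctx := ⟨P, env, t, σ⟩
  let x := σ t.origin
  let s0 : Substate :=
    { world := σ, transient := fun _ _ => 0, writes := []
      warmAddrs := t.origin :: env.coinbase :: (t.dest.toList ++ t.accessList.map Prod.fst)
      warmKeys := t.accessList.flatMap fun p => p.2.map fun k => (p.1, k)
      refund := 0, created := [], doomed := [], events := [] }
  let c0 : Config :=
    { sub := s0
      reads := [Loc.existence t.origin, Loc.code t.origin, Loc.nonce t.origin, Loc.balance t.origin]
      frames := [], halted := true }
  if validTx P env t σ then
    let s1 := s0.put t.origin
      { x with
        nonce := x.nonce + 1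
        balance := x.balance - t.gasLimit * gasPrice env t - blobGas t * env.blobBaseFee }
      [Loc.nonce t.origin, Loc.balance t.origin]
    let gas := t.gasLimit - P.intrinsicGas t
    match t.dest with
    | some d =>
      enter cx
        { c0 with
          sub := s1.transfer t.origin d t.value
          reads := Loc.code d :: transferReads t.origin d t.value ++ c0.reads, halted := false }
        { self := d, caller := t.origin, value := t.value, input := t.data
          code := (s1.world d).code, isStatic := false, own := true, target := none
          outOff := 0, outSize := 0, saved := s1, gas := gas } d []
    | none =>
      let a := createAddr P t.origin x.nonce
      openContract { c0 with sub := { s1 with warmAddrs := a :: s1.warmAddrs }, halted := false }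
        t.origin a t.value t.data gas [] true
  else c0

/-- The configuration after `n` machine steps of the transaction `t` in the state `σ`. -/
def run (P : Params) (env : BlockEnv) (t : Tx) (σ : World) (n : ℕ) : Config :=
  (step ⟨P, env, t, σ⟩)^[n] (start P env t σ)

/-- The read set: the locations read when `t` is executed in the state `σ`. -/
def Rset (P : Params) (env : BlockEnv) (t : Tx) (σ : World) : Set Loc :=
  {l | ∃ n, l ∈ (run P env t σ n).reads}

/-- The write set: the locations written, and not rolled back, when `t` is executed in `σ`. -/
def Wset (P : Params) (env : BlockEnv) (t : Tx) (σ : World) : Set Loc :=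
  {l | ∃ n, (run P env t σ n).halted = true ∧ l ∈ (run P env t σ n).sub.writes}

/-- Executing `t` in `σ` reaches the opcode `O` in the code run for the called contract: its own
code or code that it runs through `DELEGATECALL` or `CALLCODE`. -/
def Reaches (P : Params) (env : BlockEnv) (t : Tx) (σ : World) (O : Op) : Prop :=
  ∃ n f, (run P env t σ n).frames.head? = some f ∧ f.own = true ∧ f.op = O

end EVM

/-! ### The strong conflict analyzer -/

namespace Analyzer

open EVM

/-- A statement of three-address code: an instruction or a call of an internal function. -/
inductive Stmt
  | instr (o : Op)
  | call (g : ℕ)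

/-- Three-address code of a contract: bodies of its functions, and its public functions. -/
structure TAC where
  body : ℕ → List Stmt
  entry : Selector → Option ℕ

/-- The edges of the call graph. -/
def TAC.Calls (c : TAC) (f g : ℕ) : Prop := Stmt.call g ∈ c.body f

/-- There is a path from the function `f` to the opcode `O`. -/
def TAC.HasPath (c : TAC) (f : ℕ) (O : Op) : Prop :=
  ∃ g, Relation.ReflTransGen c.Calls f g ∧ Stmt.instr O ∈ c.body g

def exitOpcodes : List Op := [.call, .selfdestruct, .create, .create2]
def staticExitOpcodes : List Op := [.staticcall, .balance]

inductive Label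
  | transfer | transferFrom | approve | simplePayment
  | insideContract | staticExitsContract | exitsContract
  deriving DecidableEq

def Label.IsERC20 (l : Label) : Prop := l = .transfer ∨ l = .transferFrom ∨ l = .approve

def selTransfer : Selector := 0xa9059cbb
def selTransferFrom : Selector := 0x23b872dd
def selApprove : Selector := 0x095ea7b3

open Classical in
/-- Preprocessing: the label of the function with signature `s` of a contract with code `c`. -/
noncomputable def functionLabel (c : TAC) (s : Selector) : Label :=
  match c.entry s with
  | none => .exitsContract
  | some f =>
    if s = selTransfer then .transfer
    else if s = selTransferFrom then .transferFrom
    else if s = selApprove then .approve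
    else if ∃ O ∈ exitOpcodes, c.HasPath f O then .exitsContract
    else if ∃ O ∈ staticExitOpcodes, c.HasPath f O then .staticExitsContract
    else .insideContract

/-- The accounts known at preprocessing, with their code (`[]` for externally owned accounts). -/
abbrev Snapshot := Address → Option Bytecode

/-- The accounts of the snapshot still exist and have the same code. -/
def Compatible (snap : Snapshot) (σ : World) : Prop :=
  ∀ a code, snap a = some code → (σ a).alive = true ∧ (σ a).code = code

def selector (t : Tx) : Option Selector :=
  if 4 ≤ t.data.length then some (BitVec.ofNat 32 (bytesToNat (t.data.take 4))) else none

/-- The label of a transaction. A payment to an externally owned account is simple; a call that does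
not name a function of a known contract, and a contract creation, may do anything. -/
noncomputable def txLabel (dec : Bytecode → TAC) (snap : Snapshot) (t : Tx) : Label :=
  match t.dest with
  | none => .exitsContract
  | some d => match snap d with
    | none => .exitsContract
    | some [] => .simplePayment
    | some (b :: bs) => match selector t with
      | none => .exitsContract
      | some s => functionLabel (dec (b :: bs)) s

/-- The `i`-th argument in the calldata, as an address. -/
def addrArg (t : Tx) (i : ℕ) : Address :=
  BitVec.ofNat 160 (bytesToNat (slice t.data (4 + 32 * i) 32))

/-- The accounts whose tokens or allowances an ERC-20 call of kind `l` is about. -/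
def tokenAccounts (l : Label) (t : Tx) : List Address :=
  match l with
  | .transfer => [t.origin, addrArg t 0]
  | .transferFrom => [t.origin, addrArg t 0, addrArg t 1]
  | .approve => [t.origin, addrArg t 0]
  | _ => []

/-- The accounts `T.origin`, `T.dest`. -/
def endpoints (t : Tx) : List Address := t.origin :: t.dest.toList

/-- The test of the analyzer for `t` placed before `u`: `u` does not read from `t`. -/
def NoReadFrom (dec : Bytecode → TAC) (snap : Snapshot) (t u : Tx) : Prop :=
  txLabel dec snap t ≠ .exitsContract ∧
  txLabel dec snap u ≠ .exitsContract ∧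
  txLabel dec snap u ≠ .staticExitsContract ∧
  ((endpoints t).Disjoint (endpoints u) ∨
    ((txLabel dec snap t).IsERC20 ∧ (txLabel dec snap u).IsERC20 ∧ t.dest = u.dest ∧
      (tokenAccounts (txLabel dec snap t) t).Disjoint (tokenAccounts (txLabel dec snap u) u)))

open Classical in
/-- The output of the analyzer for the transaction number `j` of the sequence `T`, whose indices are
the preset order: the transactions that are not suspected of a read-from conflict with it. -/
noncomputable def independenceSet (dec : Bytecode → TAC) (snap : Snapshot) {n : ℕ}
    (T : Fin n → Tx) (j : Fin n) : Finset (Fin n) :=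
  Finset.univ.filter fun i =>
    (i < j ∧ NoReadFrom dec snap (T i) (T j)) ∨ (j < i ∧ NoReadFrom dec snap (T j) (T i))

/-! ### The two standing assumptions -/

/-- Decompiler correctness: if there is no path from a public function to the opcode `O` in the
three-address code, no transaction calling the contract with that signature reaches `O`. -/
def DecompilerCorrect (P : Params) (dec : Bytecode → TAC) (snap : Snapshot) : Prop :=
  ∀ (d : Address) (code : Bytecode) (s : Selector) (f : ℕ) (O : Op),
    snap d = some code → code ≠ [] → (dec code).entry s = some f → ¬ (dec code).HasPath f O →
    ∀ (env : BlockEnv) (t : Tx) (σ : World), Compatible snap σ →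
      t.dest = some d → selector t = some s → ¬ Reaches P env t σ O

/-- The data of an ERC-20 token: balances and allowances. -/
inductive TokenCell
  | balance (a : Address)
  | allowance (owner spender : Address)

def TokenCell.Over (U : Set Address) : TokenCell → Prop
  | .balance a => a ∈ U
  | .allowance o s => o ∈ U ∧ s ∈ U

/-- The balances and allowances that an ERC-20 call of kind `l` is about. -/
def tokenCells (l : Label) (t : Tx) : List TokenCell :=
  match l with
  | .transfer => [.balance t.origin, .balance (addrArg t 0)]
  | .transferFrom =>
    [.balance (addrArg t 0), .balance (addrArg t 1), .allowance (addrArg t 0) t.origin]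
  | .approve => [.allowance t.origin (addrArg t 0)]
  | _ => []

/-- The contract `d` implements its ERC-20 functions faithfully, as far as state accesses for token
holders in `U` are concerned: balances and allowances are kept in storage cells of `d` that are
different for different data (a storage has fewer cells than there are pairs of addresses, so this
is asked for holders in `U` only); a call writes, apart from nonce and balance of the origin (fee),
only the cells of the balances and allowances it is about; and it reads, apart from code and
existence of accounts and from nonces and balances of origin and `d`, only these cells and cells of
`d` holding no balance or allowance. -/
def WellFormedERC20 (P : Params) (dec : Bytecode → TAC) (snap : Snapshot) (U : Set Address)
    (d : Address) : Prop :=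
  ∃ slot : TokenCell → Word, Set.InjOn slot {c | c.Over U} ∧
    ∀ t : Tx, t.dest = some d → (txLabel dec snap t).IsERC20 →
      (∀ a ∈ tokenAccounts (txLabel dec snap t) t, a ∈ U) →
      ∀ (env : BlockEnv) (σ : World), Compatible snap σ →
        (∀ l ∈ Wset P env t σ,
          l = .nonce t.origin ∨ l = .balance t.origin ∨
          ∃ c ∈ tokenCells (txLabel dec snap t) t, l = .storage d (slot c)) ∧
        (∀ l ∈ Rset P env t σ,
          (∃ a, l = .code a ∨ l = .existence a) ∨
          (∃ a ∈ endpoints t, l = .nonce a ∨ l = .balance a) ∨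
          (∃ c ∈ tokenCells (txLabel dec snap t) t, l = .storage d (slot c)) ∨
          (∃ k, l = .storage d k ∧ ∀ c : TokenCell, c.Over U → k ≠ slot c))

/-- The accounts whose tokens or allowances some ERC-20 transaction of the sequence is about. -/
def tokenHolders (dec : Bytecode → TAC) (snap : Snapshot) {n : ℕ} (T : Fin n → Tx) : Set Address :=
  {a | ∃ i, a ∈ tokenAccounts (txLabel dec snap (T i)) (T i)}

end Analyzer

/-!
A transaction that is not labeled `exitsContract` touches very little of the state. Outside the
ERC-20 case, decompiler correctness says that the code run on behalf of the called contract `d`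
never reaches `CALL`, `SELFDESTRUCT`, `CREATE` or `CREATE2`. Hence every frame either acts for `d`
itself (it was opened by the transaction or by `DELEGATECALL` and `CALLCODE`), or lies above a
`STATICCALL` and can write nothing. So the only writes are to the cells of `d` and, through the fee
and the value transfer, to nonce and balance of origin and destination (`ownState`). The existence
of an account never changes: the origin has a positive nonce from the beginning on, the destination
exists in a compatible state, and no contract is created or destroyed. If `STATICCALL` and `BALANCE`
are not reached either, every frame acts for `d`, and the reads, too, are confined to `ownState` and
to code and existence of accounts. Both facts are one invariant of the machine, `ConfigInv`, whose
preservation by a step is `ConfigInv.step`.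

For ERC-20 transactions the same bounds are part of the well-formedness assumption. When two
transactions have disjoint endpoints, the bounds give disjoint sets, since code and existence are
never written. For two ERC-20 transactions to one token, cells of the token do not meet because the
assignment of cells is injective on the holders of the sequence, and the origin of the first is not
the token, because the origin of a valid transaction has no code.
-/

open EVM

/-! ### Locations of the origin and of the called contract -/

namespace EVM

/-- Nonces and balances of `o` and `d`, and the storage of `d`. -/
def ownState (o d : Address) : Set Loc :=
  {l | (∃ a, (a = o ∨ a = d) ∧ (l = .nonce a ∨ l = .balance a)) ∨ ∃ k, l = .storage d k}

/-- `ownState`, together with code and existence of all accounts. -/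
def readable (o d : Address) : Set Loc :=
  {l | (∃ a, l = .code a ∨ l = .existence a) ∨ l ∈ ownState o d}

section

variable {o d : Address}

@[simp] lemma nonce_mem_ownState {a : Address} : Loc.nonce a ∈ ownState o d ↔ a = o ∨ a = d := by
  simp [ownState]

@[simp] lemma balance_mem_ownState {a : Address} :
    Loc.balance a ∈ ownState o d ↔ a = o ∨ a = d := by
  simp [ownState]

@[simp] lemma storage_mem_ownState {a : Address} {k : Word} :
    Loc.storage a k ∈ ownState o d ↔ a = d := by
  simp [ownState]

@[simp] lemma code_notMem_ownState {a : Address} : Loc.code a ∉ ownState o d := by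
  simp [ownState]

@[simp] lemma existence_notMem_ownState {a : Address} : Loc.existence a ∉ ownState o d := by
  simp [ownState]

@[simp] lemma code_mem_readable {a : Address} : Loc.code a ∈ readable o d := by
  simp [readable]

@[simp] lemma existence_mem_readable {a : Address} : Loc.existence a ∈ readable o d := by
  simp [readable]

@[simp] lemma nonce_mem_readable {a : Address} : Loc.nonce a ∈ readable o d ↔ a = o ∨ a = d := by
  simp [readable]

@[simp] lemma balance_mem_readable {a : Address} :
    Loc.balance a ∈ readable o d ↔ a = o ∨ a = d := by
  simp [readable]

@[simp] lemma storage_mem_readable {a : Address} {k : Word} :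
    Loc.storage a k ∈ readable o d ↔ a = d := by
  simp [readable]

/-! ### The invariant of the machine -/

/-- Only `ownState o d` has been written and no account has been destroyed. The nonce of the origin
is kept positive so that paying fees never changes the existence of the origin. -/
structure SubInv (o d : Address) (s : Substate) : Prop where
  nonce_ne : (s.world o).nonce ≠ 0
  doomed : s.doomed = []
  writes : ∀ l ∈ s.writes, l ∈ ownState o d

/-- The frame runs for `d` itself, or is a static frame opened by way of a `STATICCALL`. The latter is
excluded when `strict` holds. -/
structure FrameInv (strict : Prop) (o d : Address) (f : Frame) : Prop where
  scope : (f.own = true ∧ f.self = d) ∨ (¬ strict ∧ f.own = false ∧ f.isStatic = true)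
  target : f.target = none
  saved : SubInv o d f.saved

/-- The invariant of an execution; reads are tracked only when `strict` holds. -/
structure ConfigInv (strict : Prop) (o d : Address) (c : Config) : Prop where
  sub : SubInv o d c.sub
  reads : strict → ∀ l ∈ c.reads, l ∈ readable o d
  frames : ∀ f ∈ c.frames, FrameInv strict o d f

/-- `g` belongs to the same call as `f`: the data fixed when the frame was entered agree. -/
structure Frame.SameCall (f g : Frame) : Prop where
  self : g.self = f.self
  own : g.own = f.own
  isStatic : g.isStatic = f.isStatic
  target : g.target = f.target
  saved : g.saved = f.saved

variable {strict : Prop}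

lemma FrameInv.of_sameCall {f g : Frame} (hf : FrameInv strict o d f) (h : f.SameCall g) :
    FrameInv strict o d g :=
  ⟨by rw [h.own, h.self, h.isStatic]; exact hf.scope, h.target.trans hf.target,
    by rw [h.saved]; exact hf.saved⟩

lemma FrameInv.self_eq_of_strict {f : Frame} (hf : FrameInv strict o d f) (h : strict) :
    f.self = d := by
  rcases hf.scope with h1 | h1
  · exact h1.2
  · exact absurd h h1.1

lemma FrameInv.self_eq_of_not_static {f : Frame} (hf : FrameInv strict o d f)
    (h : f.isStatic = false) : f.self = d := by
  rcases hf.scope with h1 | h1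
  · exact h1.2
  · simp [h] at h1

lemma SubInv.put {s : Substate} (h : SubInv o d s) {a : Address} {x : Account} {ls : List Loc}
    (ha : x.alive = (s.world a).alive) (hn : a = o → x.nonce ≠ 0)
    (hl : ∀ l ∈ ls, l ∈ ownState o d) : SubInv o d (s.put a x ls) where
  nonce_ne := by
    by_cases e : o = a
    · subst e; simpa [Substate.put] using hn rfl
    · simpa [Substate.put, Function.update_of_ne e] using h.nonce_ne
  doomed := h.doomed
  writes := by
    simp only [Substate.put, ha, if_true, List.append_nil, List.mem_append]
    rintro l (hl' | hl')
    · exact hl l hl'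
    · exact h.writes l hl'

lemma pureStep_sameCall {cx : Ctx} {f f1 : Frame} {op : Op} (h : pureStep cx f op = some f1) :
    f.SameCall f1 := by
  unfold pureStep at h
  split at h <;> (try split at h) <;> (try split at h) <;> (try split at h) <;>
    first
    | (simp only [Option.some.injEq] at h; subst h; exact ⟨rfl, rfl, rfl, rfl, rfl⟩)
    | cases h

lemma stateStep_sameCall {cx : Ctx} {st s : Substate} {f f1 : Frame} {op : Op} {rs : List Loc}
    (h : stateStep cx st f op = some (s, rs, f1)) : f.SameCall f1 := by
  unfold stateStep at h
  split at h <;> (try split at h) <;> (try split at h) <;>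
    first
    | (simp only [Option.some.injEq, Prod.mk.injEq] at h
       obtain ⟨-, -, rfl⟩ := h; exact ⟨rfl, rfl, rfl, rfl, rfl⟩)
    | cases h

lemma stateStep_reads {cx : Ctx} {st s : Substate} {f f1 : Frame} {op : Op} {rs : List Loc}
    (h : stateStep cx st f op = some (s, rs, f1)) (hop : op ≠ .balance) (hf : f.self = d) :
    ∀ l ∈ rs, l ∈ readable o d := by
  unfold stateStep at h
  split at h <;> (try split at h) <;> (try split at h) <;>
    first
    | exact absurd rfl hop
    | (simp only [Option.some.injEq, Prod.mk.injEq] at h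
       obtain ⟨-, rfl, -⟩ := h; simp [hf])
    | cases h

lemma stateStep_subInv {cx : Ctx} {st s : Substate} {f f1 : Frame} {op : Op} {rs : List Loc}
    (h : stateStep cx st f op = some (s, rs, f1)) (hs : SubInv o d st)
    (hf : f.isStatic = false → f.self = d) : SubInv o d s := by
  unfold stateStep at h
  split at h
  case h_7 =>
    split at h
    · split at h
      · cases h
      · rename_i hst
        simp only [Option.some.injEq, Prod.mk.injEq] at h
        obtain ⟨rfl, -, -⟩ := h
        refine hs.put rfl ?_ ?_
        · rintro e; simpa [e] using hs.nonce_ne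
        · simp [hf (by simpa using hst)]
    · cases h
  all_goals (try split at h) <;> (try split at h) <;>
    first
    | (simp only [Option.some.injEq, Prod.mk.injEq] at h
       obtain ⟨rfl, -, -⟩ := h; exact ⟨hs.nonce_ne, hs.doomed, hs.writes⟩)
    | cases h

lemma finalize_inv {cx : Ctx} {c : Config} (ho : cx.tx.origin = o)
    (h : ConfigInv strict o d c) (gasLeft : ℕ) : ConfigInv strict o d (finalize cx c gasLeft) := by
  have hn := h.sub.nonce_ne
  subst ho
  refine ⟨?_, ?_, by simp [finalize]⟩
  · have hd : c.sub.doomed = [] := h.sub.doomed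
    simp only [finalize]
    rw [show ∀ (s : Substate) a x ls, (s.put a x ls).doomed = s.doomed from fun _ _ _ _ => rfl, hd,
      List.foldl_nil]
    refine h.sub.put ?_ (fun _ => hn) ?_ <;> simp [Account.alive, hn]
  · intro hst l hl
    rcases List.mem_cons.1 hl with rfl | hl
    · simp
    · exact h.reads hst l hl

lemma finish_inv {cx : Ctx} {c : Config} {f : Frame} {rest : List Frame} (ho : cx.tx.origin = o)
    (hs : SubInv o d c.sub) (hr : strict → ∀ l ∈ c.reads, l ∈ readable o d)
    (hf : FrameInv strict o d f) (hrest : ∀ g ∈ rest, FrameInv strict o d g) (r : Outcome) :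
    ConfigInv strict o d (finish cx c f rest r) := by
  have hq : SubInv o d (settle cx c.sub f r).1 := by
    unfold settle
    split
    · exact hf.saved
    · exact hf.saved
    · rw [hf.target]; exact hs
  unfold finish
  cases rest with
  | nil =>
    -- `finalize` ignores the frames, so they may be taken to be empty.
    exact finalize_inv (c := { c with sub := (settle cx c.sub f r).1, frames := [] }) ho
      ⟨hq, hr, by simp⟩ _
  | cons p ps =>
    refine ⟨hq, hr, ?_⟩
    simp only [List.mem_cons, forall_eq_or_imp] at hrest ⊢
    exact ⟨hrest.1.of_sameCall ⟨rfl, rfl, rfl, rfl, rfl⟩, hrest.2⟩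

lemma enter_inv {cx : Ctx} {c : Config} {f : Frame} {ps : List Frame} (ho : cx.tx.origin = o)
    (hs : SubInv o d c.sub) (hr : strict → ∀ l ∈ c.reads, l ∈ readable o d)
    (hf : FrameInv strict o d f) (hps : ∀ g ∈ ps, FrameInv strict o d g) (a : Address) :
    ConfigInv strict o d (enter cx c f a ps) := by
  unfold enter
  split
  · split
    · split
      · refine finish_inv ho hs hr ?_ hps _
        exact hf.of_sameCall ⟨rfl, rfl, rfl, rfl, rfl⟩
      · exact finish_inv ho hs hr hf hps _
    · exact finish_inv ho hs hr hf hps _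
  · exact ⟨hs, hr, by simpa using ⟨hf, hps⟩⟩

/-- A message call that the invariant admits moves no ether, and its frame is again one for `d` or a
static one. A `CALL` can only come from a static frame, where a non-zero value is an exception. -/
lemma callReq_spec {f : Frame} {op : Op} {q : CallReq} (h : callReq f op = some q)
    (hf : FrameInv strict o d f) (hcall : op = .call → f.own = false)
    (hstat : strict → op ≠ .staticcall) :
    q.moved = 0 ∧ ((q.own = true ∧ q.self = d) ∨
      (¬ strict ∧ q.own = false ∧ q.isStatic = true)) := by
  have hscope := hf.scope
  unfold callReq at h
  split at h
  · have ho := hcall rfl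
    split at h
    · split at h
      · cases h
      · rename_i hv
        simp only [Option.some.injEq] at h
        subst h
        simp_all
    · cases h
  · split at h
    · simp only [Option.some.injEq] at h
      subst h
      simp_all
    · cases h
  · split at h
    · simp only [Option.some.injEq] at h
      subst h
      simp_all
    · cases h
  · split at h
    · simp only [Option.some.injEq] at h
      subst h
      exact ⟨rfl, .inr ⟨fun hs => hstat hs rfl, rfl, rfl⟩⟩
    · cases h
  · cases h

lemma doCall_inv {cx : Ctx} {c : Config} {f : Frame} {rest : List Frame} {q : CallReq}
    (ho : cx.tx.origin = o)
    (hs : SubInv o d c.sub) (hr : strict → ∀ l ∈ c.reads, l ∈ readable o d)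
    (hf : FrameInv strict o d f) (hrest : ∀ g ∈ rest, FrameInv strict o d g)
    (hmoved : q.moved = 0)
    (hq : (q.own = true ∧ q.self = d) ∨ (¬ strict ∧ q.own = false ∧ q.isStatic = true)) :
    ConfigInv strict o d (doCall cx c f rest q) := by
  have hr1 : strict → ∀ l ∈ Loc.code q.codeAddr ::
      (if q.needed = 0 then [] else [Loc.balance f.self])
        ++ transferReads f.self q.self q.moved ++ c.reads, l ∈ readable o d := by
    intro hst l hl
    have hself := hf.self_eq_of_strict hst
    simp only [transferReads, hmoved, if_true, List.append_nil, List.cons_append, List.mem_cons,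
      List.mem_append] at hl
    rcases hl with rfl | hl | hl
    · simp
    · split at hl
      · simp at hl
      · simp only [List.mem_singleton] at hl
        simp [hl, hself]
    · exact hr hst l hl
  unfold doCall
  dsimp only
  split
  · refine ⟨hs, hr1, ?_⟩
    simp only [List.mem_cons, forall_eq_or_imp]
    exact ⟨hf.of_sameCall ⟨rfl, rfl, rfl, rfl, rfl⟩, hrest⟩
  · refine enter_inv ho ?_ hr1 ⟨hq, rfl, hs⟩ ?_ _
    · simpa [Substate.transfer, hmoved] using hs
    · simp only [List.mem_cons, forall_eq_or_imp]
      exact ⟨hf.of_sameCall ⟨rfl, rfl, rfl, rfl, rfl⟩, hrest⟩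

/-- The opcodes excluded by the labels occur in no frame of the called contract. -/
structure Confined (strict : Prop) (f : Frame) (op : Op) : Prop where
  exit : op ∈ Analyzer.exitOpcodes → f.own = false
  staticExit : strict → op ∈ Analyzer.staticExitOpcodes → f.own = false

lemma exec_inv {cx : Ctx} {c : Config} {f : Frame} {rest : List Frame} {op : Op}
    (ho : cx.tx.origin = o)
    (hs : SubInv o d c.sub) (hr : strict → ∀ l ∈ c.reads, l ∈ readable o d)
    (hf : FrameInv strict o d f) (hrest : ∀ g ∈ rest, FrameInv strict o d g)
    (hop : Confined strict f op) : ConfigInv strict o d (exec cx c f rest op) := by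
  have hfin := finish_inv ho hs hr hf hrest
  have hstatic : op ∈ Analyzer.exitOpcodes → f.isStatic = true := by
    intro h
    have := hop.exit h
    have := hf.scope
    simp_all
  have hne : ∀ O ∈ Analyzer.staticExitOpcodes, strict → op ≠ O := by
    rintro O hO hst rfl
    have h1 := hop.staticExit hst hO
    have h2 := hf.scope
    simp_all
  have hcall : ConfigInv strict o d (match callReq f op with
      | some q => doCall cx c f rest q
      | none => finish cx c f rest .exception) := by
    split
    · rename_i q hq
      obtain ⟨h1, h2⟩ := callReq_spec hq hf
        (fun e => hop.exit (by simp [e, Analyzer.exitOpcodes]))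
        (hne _ (by simp [Analyzer.staticExitOpcodes]))
      exact doCall_inv ho hs hr hf hrest h1 h2
    · exact hfin _
  have hstate : ConfigInv strict o d (match stateStep cx c.sub f op with
      | some (s, rs, f1) =>
        if 1024 < f1.stack.length then finish cx c f rest .exception
        else { c with sub := s, reads := rs ++ c.reads, frames := f1 :: rest }
      | none => finish cx c f rest .exception) := by
    split
    · rename_i s rs f1 h
      split
      · exact hfin _
      · refine ⟨stateStep_subInv h hs hf.self_eq_of_not_static, ?_, ?_⟩
        · intro hst l hl
          rcases List.mem_append.1 hl with hl | hl
          · exact stateStep_reads h (hne _ (by simp [Analyzer.staticExitOpcodes]) hst)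
              (hf.self_eq_of_strict hst) l hl
          · exact hr hst l hl
        · simp only [List.mem_cons, forall_eq_or_imp]
          exact ⟨hf.of_sameCall (stateStep_sameCall h), hrest⟩
    · exact hfin _
  have hpure : ConfigInv strict o d (match pureStep cx f op with
      | some f1 =>
        if 1024 < f1.stack.length then finish cx c f rest .exception
        else { c with frames := f1 :: rest }
      | none => finish cx c f rest .exception) := by
    split
    · rename_i f1 h
      split
      · exact hfin _
      · refine ⟨hs, hr, ?_⟩
        simp only [List.mem_cons, forall_eq_or_imp]
        exact ⟨hf.of_sameCall (pureStep_sameCall h), hrest⟩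
    · exact hfin _
  -- A creation or self-destruction can only be tried in a static frame, where it fails.
  cases op
  case selfdestruct =>
    have := hstatic (by simp [Analyzer.exitOpcodes])
    simp only [exec, this, if_true]
    split <;> exact hfin _
  case create =>
    have := hstatic (by simp [Analyzer.exitOpcodes])
    simp only [exec, doCreate, this, true_or, if_true]
    split <;> exact hfin _
  case create2 =>
    have := hstatic (by simp [Analyzer.exitOpcodes])
    simp only [exec, doCreate, this, true_or, if_true]
    split <;> exact hfin _
  case ret => simp only [exec]; split <;> exact hfin _
  case revert => simp only [exec]; split <;> exact hfin _
  case halt => exact hfin _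
  case invalid => exact hfin _
  all_goals first | exact hpure | exact hstate | exact hcall

lemma gasReads_readable {f : Frame} (op : Op) (hf : f.self = d) :
    ∀ l ∈ gasReads f op, l ∈ readable o d := by
  unfold gasReads
  split
  · split <;> simp [hf]
  · simp
  · simp [hf]
  · simp

lemma ConfigInv.step {cx : Ctx} {c : Config} (ho : cx.tx.origin = o)
    (h : ConfigInv strict o d c)
    (hop : ∀ f, c.frames.head? = some f → Confined strict f f.op) :
    ConfigInv strict o d (step cx c) := by
  unfold EVM.step
  split
  · exact h
  · rename_i f rest hc
    have hfr := h.frames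
    simp only [hc, List.mem_cons, forall_eq_or_imp] at hfr
    have hr : strict → ∀ l ∈ gasReads f f.op ++ c.reads, l ∈ readable o d := by
      intro hst l hl
      rcases List.mem_append.1 hl with hl | hl
      · exact gasReads_readable _ (hfr.1.self_eq_of_strict hst) l hl
      · exact h.reads hst l hl
    have hc1 := hop f (by simp [hc])
    dsimp only
    split
    · exact finish_inv (c := { c with reads := gasReads f f.op ++ c.reads }) ho h.sub hr
        hfr.1 hfr.2 _
    · exact exec_inv ho ⟨h.sub.nonce_ne, h.sub.doomed, h.sub.writes⟩ hr
        (hfr.1.of_sameCall ⟨rfl, rfl, rfl, rfl, rfl⟩) hfr.2 ⟨hc1.exit, hc1.staticExit⟩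

end

/-! ### Transactions whose execution is confined -/

lemma alive_of_nonce_ne {x : Account} (h : x.nonce ≠ 0) : x.alive = true := by
  simp [Account.alive, h]

/-- The transfer of the value of a transaction keeps the invariant: it can change the existence of
neither account, as both exist and the payer has a positive nonce. -/
lemma SubInv.transfer {o d : Address} {s : Substate} (h : SubInv o d s)
    (hd : (s.world d).alive = true) (v : ℕ) : SubInv o d (s.transfer o d v) := by
  unfold Substate.transfer
  split
  · exact h
  · have h1 : SubInv o d (s.put o { s.world o with balance := (s.world o).balance - v }
        [Loc.balance o]) :=
      h.put (by rw [alive_of_nonce_ne h.nonce_ne]; exact alive_of_nonce_ne h.nonce_ne)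
        (fun _ => h.nonce_ne) (by simp)
    have hd1 : ((s.put o { s.world o with balance := (s.world o).balance - v }
        [Loc.balance o]).world d).alive = true := by
      by_cases e : d = o
      · subst e; exact alive_of_nonce_ne h1.nonce_ne
      · simpa [Substate.put, Function.update_of_ne e] using hd
    refine h1.put ?_ ?_ (by simp)
    · rw [hd1]
      simp only [Account.alive, decide_eq_true_eq] at hd1 ⊢
      omega
    · rintro rfl; exact h1.nonce_ne

variable {P : Params} {env : BlockEnv} {t : Tx} {σ : World} {d : Address} {strict : Prop}

lemma run_succ (n : ℕ) : run P env t σ (n + 1) = step ⟨P, env, t, σ⟩ (run P env t σ n) := by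
  simp [run, Function.iterate_succ_apply']

/-- A transaction that is not valid reads only its origin, and writes nothing. -/
lemma run_of_not_valid (h : validTx P env t σ = false) (n : ℕ) :
    (run P env t σ n).sub.writes = [] ∧ (run P env t σ n).reads =
      [Loc.existence t.origin, Loc.code t.origin, Loc.nonce t.origin, Loc.balance t.origin] ∧
      (run P env t σ n).frames = [] := by
  induction n with
  | zero => simp [run, start, h]
  | succ n ih =>
    rw [run_succ, step, ih.2.2]
    exact ih

lemma start_inv (hd : t.dest = some d) (halive : (σ d).alive = true)
    (hv : validTx P env t σ = true) : ConfigInv strict t.origin d (start P env t σ) := by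
  have hx : (σ t.origin).alive = true := by
    simp only [validTx, Bool.and_eq_true] at hv
    exact hv.1
  simp only [start, hv, if_true, hd]
  have hs1 : ∀ (s0 : Substate) (b : ℕ), s0.world = σ → s0.doomed = [] → s0.writes = [] →
      SubInv t.origin d (s0.put t.origin
        { σ t.origin with nonce := (σ t.origin).nonce + 1, balance := b }
        [Loc.nonce t.origin, Loc.balance t.origin]) := by
    rintro s0 b rfl h1 h2
    have e : Account.alive { s0.world t.origin with
        nonce := (s0.world t.origin).nonce + 1, balance := b } = (s0.world t.origin).alive := by
      rw [hx]; exact alive_of_nonce_ne (Nat.succ_ne_zero _)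
    refine ⟨by simp [Substate.put], h1, ?_⟩
    simp [Substate.put, hx, h2, alive_of_nonce_ne]
  refine enter_inv (cx := ⟨P, env, t, σ⟩) rfl ?_ ?_ ?_ (List.forall_mem_nil _) d
  · refine SubInv.transfer (hs1 _ _ rfl rfl rfl) ?_ _
    by_cases e : d = t.origin
    · subst e; exact alive_of_nonce_ne (by simp [Substate.put])
    · simpa [Substate.put, Function.update_of_ne e] using halive
  · intro _ l hl
    simp only [transferReads] at hl
    split at hl
    · simp at hl
      rcases hl with rfl | rfl | rfl | rfl | rfl <;> simp
    · simp at hl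
      rcases hl with rfl | rfl | rfl | rfl | rfl | rfl | rfl <;> simp
  · exact ⟨.inl ⟨rfl, rfl⟩, rfl, hs1 _ _ rfl rfl rfl⟩

lemma run_inv (hd : t.dest = some d) (halive : (σ d).alive = true)
    (hv : validTx P env t σ = true)
    (hexit : ∀ O ∈ Analyzer.exitOpcodes, ¬ Reaches P env t σ O)
    (hstat : strict → ∀ O ∈ Analyzer.staticExitOpcodes, ¬ Reaches P env t σ O) (n : ℕ) :
    ConfigInv strict t.origin d (run P env t σ n) := by
  induction n with
  | zero => exact start_inv hd halive hv
  | succ n ih =>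
    rw [run_succ]
    refine ih.step rfl fun f hf => ⟨fun h => ?_, fun hst h => ?_⟩
    · by_contra ho
      exact hexit _ h ⟨n, f, hf, by simpa using ho, rfl⟩
    · by_contra ho
      exact hstat hst _ h ⟨n, f, hf, by simpa using ho, rfl⟩

lemma Wset_subset_ownState (hd : t.dest = some d) (halive : (σ d).alive = true)
    (hexit : ∀ O ∈ Analyzer.exitOpcodes, ¬ Reaches P env t σ O) :
    Wset P env t σ ⊆ ownState t.origin d := by
  rintro l ⟨n, -, hl⟩
  cases hv : validTx P env t σ
  · simp [(run_of_not_valid hv n).1] at hl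
  · exact (run_inv (strict := False) hd halive hv hexit False.elim n).sub.writes l hl

lemma Rset_subset_readable (hd : t.dest = some d) (halive : (σ d).alive = true)
    (hexit : ∀ O ∈ Analyzer.exitOpcodes, ¬ Reaches P env t σ O)
    (hstat : ∀ O ∈ Analyzer.staticExitOpcodes, ¬ Reaches P env t σ O) :
    Rset P env t σ ⊆ readable t.origin d := by
  rintro l ⟨n, hl⟩
  cases hv : validTx P env t σ
  · rw [(run_of_not_valid hv n).2.1] at hl
    simp only [List.mem_cons, List.not_mem_nil, or_false] at hl
    rcases hl with rfl | rfl | rfl | rfl <;> simp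
  · exact (run_inv (strict := True) hd halive hv hexit (fun _ => hstat) n).reads trivial l hl

/-- The origin of a valid transaction has no code. -/
lemma Wset_eq_empty_of_code_ne (h : (σ t.origin).code ≠ []) : Wset P env t σ = ∅ := by
  have hv : validTx P env t σ = false := by simp [validTx, h]
  ext l
  simp [Wset, (run_of_not_valid hv _).1]

/-! ### Payments to accounts without code -/

lemma finish_nil_frames (cx : Ctx) (c : Config) (f : Frame) (r : Outcome) :
    (finish cx c f [] r).frames = [] := rfl

/-- A call of an account without code executes at most one instruction, a `STOP`. -/
lemma run_of_code_nil (hd : t.dest = some d) (hcode : (σ d).code = []) (n : ℕ) :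
    (run P env t σ n).frames = [] ∨ ∃ f, (run P env t σ n).frames = [f] ∧ f.op = .halt := by
  cases hv : validTx P env t σ
  · exact .inl (run_of_not_valid hv n).2.2
  induction n with
  | zero =>
    simp only [run, Function.iterate_zero, id_eq, start, hv, if_true, hd, enter]
    split
    · left
      split
      · split <;> rfl
      · rfl
    · refine .inr ⟨_, rfl, ?_⟩
      have : (Function.update σ t.origin
          { σ t.origin with
            nonce := (σ t.origin).nonce + 1
            balance := (σ t.origin).balance - t.gasLimit * gasPrice env t
              - blobGas t * env.blobBaseFee } d).code = [] := by
        by_cases e : d = t.origin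
        · subst e; simpa using hcode
        · simpa [Function.update_of_ne e] using hcode
      simp only [Frame.op, Substate.put, this]
      rfl
  | succ n ih =>
    left
    rw [run_succ, step]
    rcases ih with ih | ⟨f, ih, hop⟩
    · rw [ih]; exact ih
    · rw [ih]
      simp only [hop]
      split <;> rfl

lemma not_reaches_of_code_nil (hd : t.dest = some d) (hcode : (σ d).code = []) {O : Op}
    (hO : O ≠ .halt) : ¬ Reaches P env t σ O := by
  rintro ⟨n, f, hf, -, rfl⟩
  rcases run_of_code_nil (P := P) (env := env) hd hcode n with h | ⟨g, h, hg⟩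
  · simp [h] at hf
  · simp only [h, List.head?_cons, Option.some.injEq] at hf
    exact hO (hf ▸ hg)

end EVM

/-! ### What the labels say about reads and writes -/

namespace Analyzer

variable {P : Params} {dec : Bytecode → TAC} {snap : Snapshot} {t u : Tx} {env : BlockEnv}
  {σ : World}

/-- A label other than `exitsContract` is assigned only to calls of accounts of the snapshot. -/
lemma exists_dest (h : txLabel dec snap t ≠ .exitsContract) :
    ∃ d code, t.dest = some d ∧ snap d = some code := by
  unfold txLabel at h
  split at h
  · exact absurd rfl h
  · rename_i d hd
    split at h
    · exact absurd rfl h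
    · rename_i hs; exact ⟨d, _, hd, hs⟩
    · rename_i hs; exact ⟨d, _, hd, hs⟩

lemma isERC20_ne_exits (h : (txLabel dec snap t).IsERC20) :
    txLabel dec snap t ≠ .exitsContract := by
  rcases h with h | h | h <;> simp [h]

lemma code_ne_nil_of_isERC20 (h : (txLabel dec snap t).IsERC20) {d : Address}
    (hd : t.dest = some d) {code : Bytecode} (hs : snap d = some code) : code ≠ [] := by
  rintro rfl
  have : txLabel dec snap t = .simplePayment := by simp [txLabel, hd, hs]
  simp [this, Label.IsERC20] at h

/-- The label of a transaction that is neither an ERC-20 call nor `exitsContract` excludes the exit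
opcodes, and unless it is `staticExitsContract` it excludes the static ones, too. -/
lemma not_reaches_of_label (hdec : DecompilerCorrect P dec snap) (hσ : Compatible snap σ)
    (hex : txLabel dec snap t ≠ .exitsContract) (herc : ¬ (txLabel dec snap t).IsERC20) {O : Op}
    (hO : O ∈ exitOpcodes ∨ txLabel dec snap t ≠ .staticExitsContract ∧ O ∈ staticExitOpcodes) :
    ¬ Reaches P env t σ O := by
  obtain ⟨d, code, hd, hs⟩ := exists_dest hex
  cases code with
  | nil =>
    refine not_reaches_of_code_nil hd (hσ d _ hs).2 ?_
    rintro rfl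
    simp [exitOpcodes, staticExitOpcodes] at hO
  | cons b bs =>
    simp only [txLabel, hd, hs] at hex herc hO
    cases hsel : selector t with
    | none => simp [hsel] at hex
    | some s =>
      simp only [hsel, functionLabel] at hex herc hO
      cases hf : (dec (b :: bs)).entry s with
      | none => simp [hf] at hex
      | some f =>
        simp only [hf] at hex herc hO
        refine hdec d _ s f O hs (by simp) hf (fun hp => ?_) env t σ hσ hd hsel
        split_ifs at hex herc hO with h1 h2 h3 h4 h5 <;> simp [Label.IsERC20] at herc hO hex
        · exact h4 ⟨O, hO, hp⟩
        · rcases hO with hO | hO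
          · exact h4 ⟨O, hO, hp⟩
          · exact h5 ⟨O, hO, hp⟩

lemma Wset_subset (hdec : DecompilerCorrect P dec snap) (hσ : Compatible snap σ) {U : Set Address}
    {d : Address} (hd : t.dest = some d) (hwf : WellFormedERC20 P dec snap U d)
    (hU : ∀ a ∈ tokenAccounts (txLabel dec snap t) t, a ∈ U)
    (hex : txLabel dec snap t ≠ .exitsContract) : Wset P env t σ ⊆ ownState t.origin d := by
  by_cases herc : (txLabel dec snap t).IsERC20
  · obtain ⟨slot, -, h⟩ := hwf
    intro l hl
    rcases (h t hd herc hU env σ hσ).1 l hl with rfl | rfl | ⟨c, -, rfl⟩ <;> simp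
  · obtain ⟨d', code, hd', hs⟩ := exists_dest hex
    obtain rfl : d' = d := by simpa [hd] using hd'.symm
    exact Wset_subset_ownState hd (hσ d' code hs).1
      fun O hO => not_reaches_of_label hdec hσ hex herc (.inl hO)

lemma Rset_subset (hdec : DecompilerCorrect P dec snap) (hσ : Compatible snap σ) {U : Set Address}
    {d : Address} (hd : t.dest = some d) (hwf : WellFormedERC20 P dec snap U d)
    (hU : ∀ a ∈ tokenAccounts (txLabel dec snap t) t, a ∈ U)
    (hex : txLabel dec snap t ≠ .exitsContract)
    (hst : txLabel dec snap t ≠ .staticExitsContract) :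
    Rset P env t σ ⊆ readable t.origin d := by
  by_cases herc : (txLabel dec snap t).IsERC20
  · obtain ⟨slot, -, h⟩ := hwf
    intro l hl
    rcases (h t hd herc hU env σ hσ).2 l hl with
      ⟨a, rfl | rfl⟩ | ⟨a, ha, hl⟩ | ⟨c, -, rfl⟩ | ⟨k, rfl, -⟩
    · simp
    · simp
    · have ha' : a = t.origin ∨ a = d := by simpa [endpoints, hd] using ha
      rcases hl with rfl | rfl <;> simpa using ha'
    · simp
    · simp
  · obtain ⟨d', code, hd', hs⟩ := exists_dest hex
    obtain rfl : d' = d := by simpa [hd] using hd'.symm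
    exact Rset_subset_readable hd (hσ d' code hs).1
      (fun O hO => not_reaches_of_label hdec hσ hex herc (.inl hO))
      (fun O hO => not_reaches_of_label hdec hσ hex herc (.inr ⟨hst, hO⟩))

lemma readable_inter_ownState {o d o' d' : Address} (h : List.Disjoint [o, d] [o', d']) :
    readable o' d' ∩ ownState o d = ∅ := by
  simp only [List.disjoint_cons_left, List.mem_cons, List.not_mem_nil, or_false, not_or] at h
  obtain ⟨⟨h1, h2⟩, ⟨h3, h4⟩, -⟩ := h
  ext l
  cases l <;> simp <;> grind

/-! ### Two calls of the same token -/

/-- All accounts in the name of a token cell that a call is about are among its token accounts. -/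
lemma over_of_mem_tokenCells {l : Label} {c : TokenCell} (h : c ∈ tokenCells l t) :
    c.Over {a | a ∈ tokenAccounts l t} := by
  cases l <;> simp [tokenCells] at h
  case transfer => rcases h with rfl | rfl <;> simp [TokenCell.Over, tokenAccounts]
  case transferFrom => rcases h with rfl | rfl | rfl <;> simp [TokenCell.Over, tokenAccounts]
  case approve => subst h; simp [TokenCell.Over, tokenAccounts]

lemma TokenCell.Over.mono {c : TokenCell} {U V : Set Address} (h : c.Over U) (hUV : U ⊆ V) :
    c.Over V := by
  cases c
  · exact hUV h
  · exact ⟨hUV h.1, hUV h.2⟩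

lemma TokenCell.Over.not_disjoint {c : TokenCell} {U V : Set Address} (h : c.Over U)
    (h' : c.Over V) : ∃ a, a ∈ U ∧ a ∈ V := by
  cases c
  · exact ⟨_, h, h'⟩
  · exact ⟨_, h.1, h'.1⟩

lemma origin_mem_tokenAccounts {l : Label} (h : l.IsERC20) : t.origin ∈ tokenAccounts l t := by
  rcases h with rfl | rfl | rfl <;> simp [tokenAccounts]

lemma Rset_inter_Wset_same_token {σ' : World} {env' : BlockEnv} (hσ : Compatible snap σ)
    (hσ' : Compatible snap σ') {U : Set Address} {d : Address} (hd : t.dest = some d)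
    (hd' : u.dest = some d) (hwf : WellFormedERC20 P dec snap U d)
    (ht : (txLabel dec snap t).IsERC20) (hu : (txLabel dec snap u).IsERC20)
    (htU : ∀ a ∈ tokenAccounts (txLabel dec snap t) t, a ∈ U)
    (huU : ∀ a ∈ tokenAccounts (txLabel dec snap u) u, a ∈ U)
    (hdisj : (tokenAccounts (txLabel dec snap t) t).Disjoint
      (tokenAccounts (txLabel dec snap u) u)) :
    Rset P env' u σ' ∩ Wset P env t σ = ∅ := by
  obtain ⟨d', code, hd1, hs⟩ := exists_dest (isERC20_ne_exits ht)
  obtain rfl : d' = d := by simpa [hd] using hd1.symm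
  -- If the token itself were the origin of `t`, then `t` would not be valid.
  by_cases hod : t.origin = d'
  · rw [Wset_eq_empty_of_code_ne, Set.inter_empty]
    rw [hod, (hσ d' code hs).2]
    exact code_ne_nil_of_isERC20 ht hd hs
  have hou : t.origin ≠ u.origin := fun e =>
    hdisj (origin_mem_tokenAccounts ht) (e ▸ origin_mem_tokenAccounts hu)
  have hne : ∀ a ∈ endpoints u, a ≠ t.origin := by
    intro a ha
    have : a = u.origin ∨ a = d' := by simpa [endpoints, hd'] using ha
    rcases this with rfl | rfl
    · exact hou.symm
    · exact Ne.symm hod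
  obtain ⟨slot, hinj, h⟩ := hwf
  rw [Set.eq_empty_iff_forall_notMem]
  rintro l ⟨hr, hw⟩
  have hr := (h u hd' hu huU env' σ' hσ').2 l hr
  rcases (h t hd ht htU env σ hσ).1 l hw with rfl | rfl | ⟨c, hc, rfl⟩
  · obtain ⟨a, ha, e⟩ : ∃ a ∈ endpoints u, t.origin = a := by simpa using hr
    exact hne a ha e.symm
  · obtain ⟨a, ha, e⟩ : ∃ a ∈ endpoints u, t.origin = a := by simpa using hr
    exact hne a ha e.symm
  · have hcU := (over_of_mem_tokenCells hc).mono htU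
    rcases hr with ⟨a, e | e⟩ | ⟨a, -, e | e⟩ | ⟨c', hc', e⟩ | ⟨k, e, hk⟩
    · cases e
    · cases e
    · cases e
    · cases e
    · obtain rfl : c = c' := hinj hcU ((over_of_mem_tokenCells hc').mono huU) (by simpa using e)
      obtain ⟨a, ha, ha'⟩ := (over_of_mem_tokenCells hc).not_disjoint (over_of_mem_tokenCells hc')
      exact hdisj ha ha'
    · exact hk c hcU (by simpa using e.symm)

end Analyzer

theorem mainTheorem1 (P : EVM.Params) (dec : EVM.Bytecode → Analyzer.TAC)
    (snap : Analyzer.Snapshot) (hdec : Analyzer.DecompilerCorrect P dec snap)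
    {n : ℕ} (T : Fin n → EVM.Tx)
    (herc : ∀ d : EVM.Address,
      Analyzer.WellFormedERC20 P dec snap (Analyzer.tokenHolders dec snap T) d)
    (j i : Fin n) (hi : i ∈ Analyzer.independenceSet dec snap T j) (hij : i < j)
    (env env' : EVM.BlockEnv) (σ σ' : EVM.World)
    (hσ : Analyzer.Compatible snap σ) (hσ' : Analyzer.Compatible snap σ') :
    EVM.Rset P env' (T j) σ' ∩ EVM.Wset P env (T i) σ = ∅ := by
  have hU : ∀ k, ∀ a ∈ Analyzer.tokenAccounts (Analyzer.txLabel dec snap (T k)) (T k),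
      a ∈ Analyzer.tokenHolders dec snap T := fun k a ha => ⟨k, ha⟩
  have hnr : Analyzer.NoReadFrom dec snap (T i) (T j) := by
    simpa [Analyzer.independenceSet, hij, hij.not_gt] using hi
  obtain ⟨ht, hu, hus, h⟩ := hnr
  obtain ⟨d, _, hd, -⟩ := Analyzer.exists_dest ht
  obtain ⟨d', _, hd', -⟩ := Analyzer.exists_dest hu
  rcases h with h | ⟨h1, h2, h3, h4⟩
  · have h' : List.Disjoint [(T i).origin, d] [(T j).origin, d'] := by
      simpa [Analyzer.endpoints, hd, hd'] using h
    refine Set.subset_eq_empty (Set.inter_subset_inter ?_ ?_)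
      (Analyzer.readable_inter_ownState h')
    · exact Analyzer.Rset_subset hdec hσ' hd' (herc d') (hU j) hu hus
    · exact Analyzer.Wset_subset hdec hσ hd (herc d) (hU i) ht
  · exact Analyzer.Rset_inter_Wset_same_token hσ hσ' hd (h3 ▸ hd) (herc d) h1 h2 (hU i) (hU j) h4
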